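/- **Setting.** Homology is singular homology with coefficients in $\mathbb R$. Let $1<N\le D$ be integers, let $A\subset X\subset\mathbb R^D$ and $B\subset Y\subset\mathbb R^D$ be subspaces (for instance, $X$ and $Y$ submanifolds of $\mathbb R^D$) with $A\cap Y=\emptyset$ and $X\cap B=\emptyset$, and let $$p:(X\times Y,\ A\times Y\cup X\times B)\to(\mathbb R^D,\ \mathbb R^D\setminus\{0\}),\qquad p(x,y)=x-y .$$ The *intersection number* of $\zeta\in H_N(X,A)$ and $\mu\in H_{D-N}(Y,B)$ is $$\mathscr I(\zeta,\mu)=(-1)^{D-N}\,p_*(\zeta\times\mu)\in H_D(\mathbb R^D,\mathbb R^D\setminus\{0\}),$$ where $\times$ is the homology cross product. Let $\partial_*:H_N(X,A)\to H_{N-1}(A)$ be the connecting homomorphism of the pair $(X,A)$. If $\varsigma\in H_{N-1}(A)$ is of the form $\varsigma=\partial_*\zeta$ with $\zeta\in H_N(X,A)$, then $\mathscr L(\varsigma,\mu)=\mathscr I(\zeta,\mu)$ is called a *linking number* of $\varsigma$ and $\mu$. **Proposition.** Assume that $H_N(X)=H_{N-1}(X)=0$ and $H_N(X,A)\cong H_{N-1}(A)\cong\mathbb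 R$, and fix a non-zero $\mu\in H_{D-N}(Y,B)$. If some class in $H_{N-1}(A)$ has a non-zero linking number with $\mu$, then every $\varsigma\in H_{N-1}(A)$ has exactly one linking number $\mathscr L(\varsigma,\mu)$ with $\mu$, and the map $$\mathcal H=\mathscr L(\,\cdot\,,\mu):H_{N-1}(A)\to H_D(\mathbb R^D,\mathbb R^D\setminus\{0\})$$ is an injective ($\mathbb R$-linear) homomorphism. Hence, for every identification $e:H_D(\mathbb R^D,\mathbb R^D\setminus\{0\})\xrightarrow{\ \cong\ }\mathbb R$, the real-valued linking number $\varsigma\mapsto e(\mathscr L(\varsigma,\mu))$ is an injective homomorphism $H_{N-1}(A)\to\mathbb R$: it is a complete invariant of the class $\varsigma$. -/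

import Mathlib

open CategoryTheory Limits AlgebraicTopology

namespace LinkingNumbers

section Shuffles

/-- The monotone map `[n + 1] → [p]` with `0 ↦ 0` and `i + 1 ↦ f i`. -/
def consZero {n p : ℕ} (f : Fin (n + 1) →o Fin (p + 1)) : Fin (n + 2) →o Fin (p + 1) where
  toFun := Fin.cons 0 f
  monotone' := by
    intro i j hij
    induction i using Fin.cases with
    | zero => simp
    | succ i =>
      induction j using Fin.cases with
      | zero => simp at hij
      | succ j => simpa using f.monotone (by simpa using hij)

/-- The `i`-th face map `[n] → [n + 1]`, the monotone injection that misses `i`. -/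
def faceHom {n : ℕ} (i : Fin (n + 2)) : Fin (n + 1) →o Fin (n + 2) :=
  (Fin.succAboveOrderEmb i).toOrderHom

variable {M : Type*} [AddCommGroup M]

/-- The signed sum `∑ sgn(α, β) • F α β` over all `(p, q)`-shuffles, that is, over the pairs of
monotone maps `α : [n] → [p]`, `β : [n] → [q]`, `n = p + q`, for which `i ↦ (α i, β i)` is strictly
increasing: the lattice paths from `(0, 0)` to `(p, q)` with `p` horizontal and `q` vertical unit
steps. The sign is `(-1)^k`, where `k` is the number of pairs of a vertical step and a later
horizontal step. The recursion is on the first step of the path. If it is horizontal, the rest is a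
path from `(1, 0)`; if it is vertical, the rest is a path from `(0, 1)`, and the first step precedes
all the `p` horizontal ones. For `n ≠ p + q` the sum is empty. -/
def shuffleSum : (n p q : ℕ) →
    ((Fin (n + 1) →o Fin (p + 1)) → (Fin (n + 1) →o Fin (q + 1)) → M) → M
  | 0, 0, 0, F => F OrderHom.id OrderHom.id
  | 0, _ + 1, _, _ => 0
  | 0, 0, _ + 1, _ => 0
  | n + 1, p, q, F =>
      (match p, F with
        | 0, _ => 0
        | p + 1, F => shuffleSum n p q fun α β =>
            F (consZero ((faceHom 0).comp α)) (consZero β)) +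
      (-1 : ℤ) ^ p •
      (match q, F with
        | 0, _ => 0
        | q + 1, F => shuffleSum n p q fun α β =>
            F (consZero α) (consZero ((faceHom 0).comp β)))

lemma shuffleSum_add (n p q : ℕ)
    (F G : (Fin (n + 1) →o Fin (p + 1)) → (Fin (n + 1) →o Fin (q + 1)) → M) :
    shuffleSum n p q (fun α β => F α β + G α β) = shuffleSum n p q F + shuffleSum n p q G := by
  induction n generalizing p q with
  | zero => cases p <;> cases q <;> simp [shuffleSum]
  | succ n ih => cases p <;> cases q <;> simp [shuffleSum, ih] <;> abel

lemma map_shuffleSum {M' : Type*} [AddCommGroup M'] (f : M →+ M') (n p q : ℕ)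
    (F : (Fin (n + 1) →o Fin (p + 1)) → (Fin (n + 1) →o Fin (q + 1)) → M) :
    f (shuffleSum n p q F) = shuffleSum n p q (fun α β => f (F α β)) := by
  induction n generalizing p q with
  | zero => cases p <;> cases q <;> simp [shuffleSum]
  | succ n ih => cases p <;> cases q <;> simp [shuffleSum, ih]

lemma shuffleSum_zero (n p q : ℕ) :
    shuffleSum n p q (fun _ _ => (0 : M)) = 0 := by
  simpa using (map_shuffleSum (0 : M →+ M) n p q (fun _ _ => 0)).symm

lemma shuffleSum_sum {ι : Type*} (s : Finset ι) (n p q : ℕ)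
    (F : ι → (Fin (n + 1) →o Fin (p + 1)) → (Fin (n + 1) →o Fin (q + 1)) → M) :
    shuffleSum n p q (fun α β => ∑ i ∈ s, F i α β) = ∑ i ∈ s, shuffleSum n p q (F i) := by
  classical
  induction s using Finset.induction_on with
  | empty => simp [shuffleSum_zero]
  | insert a s ha ih => simp [Finset.sum_insert ha, shuffleSum_add, ih]

lemma shuffleSum_zsmul (c : ℤ) (n p q : ℕ)
    (F : (Fin (n + 1) →o Fin (p + 1)) → (Fin (n + 1) →o Fin (q + 1)) → M) :
    shuffleSum n p q (fun α β => c • F α β) = c • shuffleSum n p q F :=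
  (map_shuffleSum (zsmulAddGroupHom c) n p q F).symm


@[simp] lemma consZero_zero {n p : ℕ} (f : Fin (n + 1) →o Fin (p + 1)) : consZero f 0 = 0 := rfl

@[simp] lemma consZero_succ {n p : ℕ} (f : Fin (n + 1) →o Fin (p + 1)) (i : Fin (n + 1)) :
    consZero f i.succ = f i := rfl

@[simp] lemma faceHom_apply {n : ℕ} (i : Fin (n + 2)) (j : Fin (n + 1)) :
    faceHom i j = i.succAbove j := rfl

lemma consZero_comp_faceHom_zero {n p : ℕ} (f : Fin (n + 1) →o Fin (p + 1)) :
    (consZero f).comp (faceHom 0) = f := by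
  ext i; simp

lemma consZero_comp_faceHom_succ {n p : ℕ} (f : Fin (n + 2) →o Fin (p + 1)) (i : Fin (n + 2)) :
    (consZero f).comp (faceHom i.succ) = consZero (f.comp (faceHom i)) := by
  ext j
  induction j using Fin.cases <;> simp

lemma faceHom_succ_comp_consZero {n p : ℕ} (f : Fin (n + 1) →o Fin (p + 1)) (i : Fin (p + 1)) :
    (faceHom i.succ).comp (consZero f) = consZero ((faceHom i.succ).comp f) := by
  ext j
  induction j using Fin.cases <;> simp

lemma faceHom_succ_comp_faceHom_zero {n p : ℕ} (f : Fin (n + 1) →o Fin (p + 1)) (i : Fin (p + 2)) :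
    (faceHom i.succ).comp ((faceHom 0).comp f) = (faceHom 0).comp ((faceHom i).comp f) := by
  ext j
  simp

/-- The part of a shuffle sum over the paths whose first step is horizontal. -/
def stepLeft : (n p q : ℕ) →
    ((Fin (n + 2) →o Fin (p + 1)) → (Fin (n + 2) →o Fin (q + 1)) → M) → M
  | _, 0, _, _ => 0
  | n, p + 1, q, F => shuffleSum n p q fun α β =>
            F (consZero ((faceHom 0).comp α)) (consZero β)

/-- The part of a shuffle sum over the paths whose first step is vertical, without the sign. -/
def stepRight : (n p q : ℕ) →
    ((Fin (n + 2) →o Fin (p + 1)) → (Fin (n + 2) →o Fin (q + 1)) → M) → M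
  | _, _, 0, _ => 0
  | n, p, q + 1, F => shuffleSum n p q fun α β =>
            F (consZero α) (consZero ((faceHom 0).comp β))

lemma shuffleSum_succ (n p q : ℕ)
    (F : (Fin (n + 2) →o Fin (p + 1)) → (Fin (n + 2) →o Fin (q + 1)) → M) :
    shuffleSum (n + 1) p q F = stepLeft n p q F + (-1 : ℤ) ^ p • stepRight n p q F := by
  cases p <;> cases q <;> rfl

/-- The signed sum over the faces of the first factor. -/
def faceLeft : (n p q : ℕ) →
    ((Fin (n + 1) →o Fin (p + 1)) → (Fin (n + 1) →o Fin (q + 1)) → M) → M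
  | _, 0, _, _ => 0
  | n, p + 1, q, G =>
      ∑ j : Fin (p + 2), (-1 : ℤ) ^ j.val • shuffleSum n p q fun α β => G ((faceHom j).comp α) β

/-- The signed sum over the faces of the second factor. -/
def faceRight : (n p q : ℕ) →
    ((Fin (n + 1) →o Fin (p + 1)) → (Fin (n + 1) →o Fin (q + 1)) → M) → M
  | _, _, 0, _ => 0
  | n, p, q + 1, G =>
      ∑ j : Fin (q + 2), (-1 : ℤ) ^ j.val • shuffleSum n p q fun α β => G α ((faceHom j).comp β)

lemma sum_stepLeft_faceLeft (n p q : ℕ)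
    (G : (Fin (n + 2) →o Fin (p + 2)) → (Fin (n + 2) →o Fin (q + 1)) → M) :
    ∑ j : Fin (p + 1), (-1 : ℤ) ^ j.val • stepLeft n p q (fun α β => G ((faceHom j.succ).comp α) β) =
      faceLeft n p q (fun α β => G (consZero ((faceHom 0).comp α)) (consZero β)) := by
  cases p with
  | zero => simp [stepLeft, faceLeft]
  | succ p => simp only [stepLeft, faceLeft, faceHom_succ_comp_consZero,
      faceHom_succ_comp_faceHom_zero]

lemma sum_stepRight_faceRight (n p q : ℕ)
    (G : (Fin (n + 2) →o Fin (p + 1)) → (Fin (n + 2) →o Fin (q + 2)) → M) :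
    ∑ j : Fin (q + 1), (-1 : ℤ) ^ j.val • stepRight n p q (fun α β => G α ((faceHom j.succ).comp β)) =
      faceRight n p q (fun α β => G (consZero α) (consZero ((faceHom 0).comp β))) := by
  cases q with
  | zero => simp [stepRight, faceRight]
  | succ q => simp only [stepRight, faceRight, faceHom_succ_comp_consZero,
      faceHom_succ_comp_faceHom_zero]

lemma sum_stepRight_faceLeft (n p q : ℕ)
    (G : (Fin (n + 2) →o Fin (p + 2)) → (Fin (n + 2) →o Fin (q + 2)) → M) :
    ∑ j : Fin (p + 1), (-1 : ℤ) ^ j.val •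
        stepRight n p (q + 1) (fun α β => G ((faceHom j.succ).comp α) β) =
      shuffleSum n p q (fun α β => G (consZero ((faceHom 0).comp α)) (consZero ((faceHom 0).comp β)))
      - faceLeft n (p + 1) q (fun α β => G (consZero α) (consZero ((faceHom 0).comp β))) := by
  simp only [stepRight, faceLeft, faceHom_succ_comp_consZero]
  rw [Fin.sum_univ_succ (n := p + 1)]
  simp [pow_succ]

lemma sum_stepLeft_faceRight (n p q : ℕ)
    (G : (Fin (n + 2) →o Fin (p + 2)) → (Fin (n + 2) →o Fin (q + 2)) → M) :
    ∑ j : Fin (q + 1), (-1 : ℤ) ^ j.val •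
        stepLeft n (p + 1) q (fun α β => G α ((faceHom j.succ).comp β)) =
      shuffleSum n p q (fun α β => G (consZero ((faceHom 0).comp α)) (consZero ((faceHom 0).comp β)))
      - faceRight n p (q + 1) (fun α β => G (consZero ((faceHom 0).comp α)) (consZero β)) := by
  simp only [stepLeft, faceRight, faceHom_succ_comp_consZero]
  rw [Fin.sum_univ_succ (n := q + 1)]
  simp [pow_succ]

/-- The boundary of the shuffle sum consists of the faces of the two factors. -/
lemma shuffleSum_boundary (n p q : ℕ)
    (G : (Fin (n + 1) →o Fin (p + 1)) → (Fin (n + 1) →o Fin (q + 1)) → M) :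
    ∑ i : Fin (n + 2), (-1 : ℤ) ^ i.val •
      shuffleSum (n + 1) p q (fun α β => G (α.comp (faceHom i)) (β.comp (faceHom i))) =
    faceLeft n p q G + (-1 : ℤ) ^ p • faceRight n p q G := by
  induction n generalizing p q with
  | zero =>
    have h1 : (consZero (faceHom (n := 0) 0)).comp (faceHom 1) = faceHom 1 := by
      ext i; fin_cases i; rfl
    have h2 : (consZero (OrderHom.id (α := Fin 1))).comp (faceHom 1) = OrderHom.id := by
      ext i; fin_cases i; rfl
    have h3 : ∀ f : Fin 1 →o Fin 2, f.comp OrderHom.id = f := fun _ => rfl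
    rcases p with _ | _ | p <;> rcases q with _ | _ | q <;>
      simp [shuffleSum, faceLeft, faceRight, Fin.sum_univ_succ, consZero_comp_faceHom_zero,
        h1, h2, h3]
  | succ n ih =>
    have L : ∀ (p q : ℕ) (G : (Fin (n + 2) →o Fin (p + 2)) → (Fin (n + 2) →o Fin (q + 1)) → M),
        faceLeft (n + 1) (p + 1) q G =
          shuffleSum (n + 1) p q (fun α β => G ((faceHom 0).comp α) β) -
          ∑ j : Fin (p + 1), (-1 : ℤ) ^ j.val •
            stepLeft n p q (fun α β => G ((faceHom j.succ).comp α) β) -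
          (-1 : ℤ) ^ p • ∑ j : Fin (p + 1), (-1 : ℤ) ^ j.val •
            stepRight n p q (fun α β => G ((faceHom j.succ).comp α) β) := by
      intro p q G
      simp only [faceLeft]
      rw [Fin.sum_univ_succ]
      simp only [shuffleSum_succ n, Fin.val_succ, pow_succ, mul_neg_one, neg_smul, smul_add,
        Finset.sum_add_distrib, Finset.sum_neg_distrib, Finset.smul_sum, Fin.val_zero, pow_zero,
        one_smul, smul_comm ((-1 : ℤ) ^ p)]
      abel
    have R : ∀ (p q : ℕ) (G : (Fin (n + 2) →o Fin (p + 1)) → (Fin (n + 2) →o Fin (q + 2)) → M),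
        faceRight (n + 1) p (q + 1) G =
          shuffleSum (n + 1) p q (fun α β => G α ((faceHom 0).comp β)) -
          ∑ j : Fin (q + 1), (-1 : ℤ) ^ j.val •
            stepLeft n p q (fun α β => G α ((faceHom j.succ).comp β)) -
          (-1 : ℤ) ^ p • ∑ j : Fin (q + 1), (-1 : ℤ) ^ j.val •
            stepRight n p q (fun α β => G α ((faceHom j.succ).comp β)) := by
      intro p q G
      simp only [faceRight]
      rw [Fin.sum_univ_succ]
      simp only [shuffleSum_succ n, Fin.val_succ, pow_succ, mul_neg_one, neg_smul, smul_add,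
        Finset.sum_add_distrib, Finset.sum_neg_distrib, Finset.smul_sum, Fin.val_zero, pow_zero,
        one_smul, smul_comm ((-1 : ℤ) ^ p)]
      abel
    have SL : ∀ (p q : ℕ) (G : (Fin (n + 2) →o Fin (p + 2)) → (Fin (n + 2) →o Fin (q + 1)) → M),
        ∑ i : Fin (n + 3), (-1 : ℤ) ^ i.val • stepLeft (n + 1) (p + 1) q
            (fun α β => G (α.comp (faceHom i)) (β.comp (faceHom i))) =
          shuffleSum (n + 1) p q (fun α β => G ((faceHom 0).comp α) β) -
          (faceLeft n p q (fun α β => G (consZero ((faceHom 0).comp α)) (consZero β)) +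
          (-1 : ℤ) ^ p •
            faceRight n p q (fun α β => G (consZero ((faceHom 0).comp α)) (consZero β))) := by
      intro p q G
      rw [← ih, Fin.sum_univ_succ]
      simp only [stepLeft, consZero_comp_faceHom_zero, consZero_comp_faceHom_succ, Fin.val_succ,
        pow_succ, mul_neg_one, neg_smul, Finset.sum_neg_distrib, Fin.val_zero, pow_zero, one_smul,
        OrderHom.comp_assoc, ← sub_eq_add_neg]
    have SR : ∀ (p q : ℕ) (G : (Fin (n + 2) →o Fin (p + 1)) → (Fin (n + 2) →o Fin (q + 2)) → M),
        ∑ i : Fin (n + 3), (-1 : ℤ) ^ i.val • stepRight (n + 1) p (q + 1)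
            (fun α β => G (α.comp (faceHom i)) (β.comp (faceHom i))) =
          shuffleSum (n + 1) p q (fun α β => G α ((faceHom 0).comp β)) -
          (faceLeft n p q (fun α β => G (consZero α) (consZero ((faceHom 0).comp β))) +
          (-1 : ℤ) ^ p •
            faceRight n p q (fun α β => G (consZero α) (consZero ((faceHom 0).comp β)))) := by
      intro p q G
      rw [← ih, Fin.sum_univ_succ]
      simp only [stepRight, consZero_comp_faceHom_zero, consZero_comp_faceHom_succ, Fin.val_succ,
        pow_succ, mul_neg_one, neg_smul, Finset.sum_neg_distrib, Fin.val_zero, pow_zero, one_smul,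
        OrderHom.comp_assoc, ← sub_eq_add_neg]
    have LR : ∑ i : Fin (n + 3), (-1 : ℤ) ^ i.val •
          shuffleSum (n + 2) p q (fun α β => G (α.comp (faceHom i)) (β.comp (faceHom i))) =
        ∑ i : Fin (n + 3), (-1 : ℤ) ^ i.val •
          stepLeft (n + 1) p q (fun α β => G (α.comp (faceHom i)) (β.comp (faceHom i))) +
        (-1 : ℤ) ^ p • ∑ i : Fin (n + 3), (-1 : ℤ) ^ i.val •
          stepRight (n + 1) p q (fun α β => G (α.comp (faceHom i)) (β.comp (faceHom i))) := by
      simp only [shuffleSum_succ (n + 1), smul_add, Finset.sum_add_distrib, Finset.smul_sum,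
        smul_comm ((-1 : ℤ) ^ p)]
    rw [LR]
    rcases p with _ | p <;> rcases q with _ | q
    · simp [stepLeft, stepRight, faceLeft, faceRight]
    · rw [SR, R, sum_stepRight_faceRight]
      simp [stepLeft, faceLeft]
    · rw [SL, L, sum_stepLeft_faceLeft]
      simp [stepRight, faceRight]
    · rw [SL, SR, L, R, sum_stepLeft_faceLeft, sum_stepRight_faceRight, sum_stepLeft_faceRight,
        sum_stepRight_faceLeft, pow_succ, mul_neg_one]
      module
end Shuffles

section HomologicalAlgebra

/-- The linear map out of `N` induced by a linear map `f` out of `Z` that vanishes on the kernel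
of a surjection `π : Z → N`. -/
noncomputable def descendAlong {Z N P : Type*} [AddCommGroup Z] [Module ℝ Z] [AddCommGroup N]
    [Module ℝ N] [AddCommGroup P] [Module ℝ P] (π : Z →ₗ[ℝ] N) (hπ : Function.Surjective π)
    (f : Z →ₗ[ℝ] P) (hf : ∀ z, π z = 0 → f z = 0) : N →ₗ[ℝ] P :=
  (LinearMap.ker π).liftQ f (SetLike.le_def.2 fun {z} hz => LinearMap.mem_ker.2 (hf z (LinearMap.mem_ker.1 hz))) ∘ₗ
    (π.quotKerEquivOfSurjective hπ).symm.toLinearMap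

lemma descendAlong_apply {Z N P : Type*} [AddCommGroup Z] [Module ℝ Z] [AddCommGroup N]
    [Module ℝ N] [AddCommGroup P] [Module ℝ P] (π : Z →ₗ[ℝ] N) (hπ : Function.Surjective π)
    (f : Z →ₗ[ℝ] P) (hf : ∀ z, π z = 0 → f z = 0) (z : Z) :
    descendAlong π hπ f hf (π z) = f z := by
  have : (π.quotKerEquivOfSurjective hπ).symm (π z) = Submodule.Quotient.mk z := by
    rw [LinearEquiv.symm_apply_eq]; rfl
  rw [descendAlong, LinearMap.comp_apply, LinearEquiv.coe_coe, this, Submodule.liftQ_apply]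

/-- Descending a bilinear map along two surjections. -/
noncomputable def descendAlong₂ {Z₁ N₁ Z₂ N₂ P : Type*} [AddCommGroup Z₁] [Module ℝ Z₁]
    [AddCommGroup N₁] [Module ℝ N₁] [AddCommGroup Z₂] [Module ℝ Z₂] [AddCommGroup N₂]
    [Module ℝ N₂] [AddCommGroup P] [Module ℝ P]
    (π₁ : Z₁ →ₗ[ℝ] N₁) (h₁ : Function.Surjective π₁)
    (π₂ : Z₂ →ₗ[ℝ] N₂) (h₂ : Function.Surjective π₂) (f : Z₁ →ₗ[ℝ] Z₂ →ₗ[ℝ] P)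
    (hf₁ : ∀ z₁ z₂, π₁ z₁ = 0 → f z₁ z₂ = 0) (hf₂ : ∀ z₁ z₂, π₂ z₂ = 0 → f z₁ z₂ = 0) :
    N₁ →ₗ[ℝ] N₂ →ₗ[ℝ] P :=
  (descendAlong π₂ h₂
    (descendAlong π₁ h₁ f (fun z₁ h => LinearMap.ext fun z₂ => hf₁ z₁ z₂ h)).flip
    (fun z₂ h => by
      ext x
      obtain ⟨z₁, rfl⟩ := h₁ x
      simpa [descendAlong_apply] using hf₂ z₁ z₂ h)).flip

lemma descendAlong₂_apply {Z₁ N₁ Z₂ N₂ P : Type*} [AddCommGroup Z₁] [Module ℝ Z₁]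
    [AddCommGroup N₁] [Module ℝ N₁] [AddCommGroup Z₂] [Module ℝ Z₂] [AddCommGroup N₂]
    [Module ℝ N₂] [AddCommGroup P] [Module ℝ P]
    (π₁ : Z₁ →ₗ[ℝ] N₁) (h₁ : Function.Surjective π₁)
    (π₂ : Z₂ →ₗ[ℝ] N₂) (h₂ : Function.Surjective π₂) (f : Z₁ →ₗ[ℝ] Z₂ →ₗ[ℝ] P)
    (hf₁ : ∀ z₁ z₂, π₁ z₁ = 0 → f z₁ z₂ = 0) (hf₂ : ∀ z₁ z₂, π₂ z₂ = 0 → f z₁ z₂ = 0)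
    (z₁ : Z₁) (z₂ : Z₂) :
    descendAlong₂ π₁ h₁ π₂ h₂ f hf₁ hf₂ (π₁ z₁) (π₂ z₂) = f z₁ z₂ := by
  simp [descendAlong₂, descendAlong_apply]

/-- A bilinear pairing of chain complexes which satisfies the Leibniz rule
`∂(x × y) = ∂x × y + (-1)^p x × ∂y` for `x` of degree `p`.  (The differentials out of degree `0`
vanish, so truncated subtraction is harmless here.) -/
structure ChainPairing (K L M : ChainComplex (ModuleCat.{0} ℝ) ℕ) where
  app (p q n : ℕ) : K.X p →ₗ[ℝ] L.X q →ₗ[ℝ] M.X n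
  leibniz (p q n : ℕ) (x : K.X p) (y : L.X q) :
    (M.d (n + 1) n).hom (app p q (n + 1) x y) =
      app (p - 1) q n ((K.d p (p - 1)).hom x) y +
        (-1 : ℤ) ^ p • app p (q - 1) n x ((L.d q (q - 1)).hom y)

variable {K L M : ChainComplex (ModuleCat.{0} ℝ) ℕ}

lemma next_down_nat (n : ℕ) : (ComplexShape.down ℕ).next n = n - 1 := by
  cases n <;> simp

lemma homologyπ_surjective (K : ChainComplex (ModuleCat.{0} ℝ) ℕ) (n : ℕ) :
    Function.Surjective (K.homologyπ n).hom :=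
  (ModuleCat.epi_iff_surjective _).1 inferInstance

lemma d_iCycles_apply (K : ChainComplex (ModuleCat.{0} ℝ) ℕ) (n j : ℕ) (z : K.cycles n) :
    (K.d n j).hom ((K.iCycles n).hom z) = 0 := by
  rw [← ModuleCat.comp_apply, K.iCycles_d]; rfl

lemma exists_boundary_of_homologyπ_eq_zero (K : ChainComplex (ModuleCat.{0} ℝ) ℕ) (n : ℕ)
    (z : K.cycles n) (hz : (K.homologyπ n).hom z = 0) :
    ∃ w : K.X (n + 1), (K.d (n + 1) n).hom w = (K.iCycles n).hom z := by
  have hex := ShortComplex.exact_of_g_is_cokernel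
    (ShortComplex.mk (K.toCycles (n + 1) n) (K.homologyπ n) (by simp))
    (K.homologyIsCokernel (n + 1) n (by simp))
  obtain ⟨w, hw⟩ := (ShortComplex.moduleCat_exact_iff _).1 hex z hz
  refine ⟨w, ?_⟩
  rw [← K.toCycles_i, ModuleCat.comp_apply]
  exact congrArg _ hw

/-- The homology class of a cycle. -/
noncomputable def cycleClass (M : ChainComplex (ModuleCat.{0} ℝ) ℕ) (n : ℕ) :
    LinearMap.ker (M.d n (n - 1)).hom →ₗ[ℝ] M.homology n :=
  (M.liftCycles (ModuleCat.ofHom (LinearMap.ker (M.d n (n - 1)).hom).subtype) (n - 1)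
    (next_down_nat n) (by ext x; exact x.2) ≫ M.homologyπ n).hom

lemma cycleClass_boundary (n : ℕ) (w : M.X (n + 1))
    (hw : (M.d (n + 1) n).hom w ∈ LinearMap.ker (M.d n (n - 1)).hom) :
    cycleClass M n ⟨(M.d (n + 1) n).hom w, hw⟩ = 0 := by
  have h : (M.liftCycles (ModuleCat.ofHom (LinearMap.ker (M.d n (n - 1)).hom).subtype) (n - 1)
      (next_down_nat n) (by ext x; exact x.2)).hom ⟨(M.d (n + 1) n).hom w, hw⟩ =
      (M.toCycles (n + 1) n).hom w := by
    apply (ModuleCat.mono_iff_injective (M.iCycles n)).1 inferInstance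
    rw [← ModuleCat.comp_apply, ← ModuleCat.comp_apply, M.liftCycles_i, M.toCycles_i]
    rfl
  unfold cycleClass
  rw [ModuleCat.comp_apply]
  erw [h]
  rw [← ModuleCat.comp_apply, M.toCycles_comp_homologyπ]
  rfl

lemma ChainPairing.app_mem_ker (B : ChainPairing K L M) (p q n : ℕ) (x : K.cycles p)
    (y : L.cycles q) : B.app p q n ((K.iCycles p).hom x) ((L.iCycles q).hom y) ∈
      LinearMap.ker (M.d n (n - 1)).hom := by
  rw [LinearMap.mem_ker]
  cases n with
  | zero => rw [M.shape _ _ (by simp)]; rfl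
  | succ n =>
    have h := B.leibniz p q n ((K.iCycles p).hom x) ((L.iCycles q).hom y)
    rw [d_iCycles_apply, d_iCycles_apply] at h
    simpa using h

/-- The pairing on cycles, with values in homology classes. -/
noncomputable def ChainPairing.onCycles (B : ChainPairing K L M) (p q n : ℕ) :
    K.cycles p →ₗ[ℝ] L.cycles q →ₗ[ℝ] M.homology n :=
  LinearMap.mk₂ ℝ (fun x y => cycleClass M n ⟨_, B.app_mem_ker p q n x y⟩)
    (fun x x' y => by rw [← map_add]; congr 1; ext; simp)
    (fun c x y => by rw [← map_smul]; congr 1; ext; simp)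
    (fun x y y' => by rw [← map_add]; congr 1; ext; simp)
    (fun c x y => by rw [← map_smul]; congr 1; ext; simp)

lemma ChainPairing.onCycles_apply (B : ChainPairing K L M) (p q n : ℕ) (x : K.cycles p)
    (y : L.cycles q) : B.onCycles p q n x y = cycleClass M n ⟨_, B.app_mem_ker p q n x y⟩ := rfl

lemma cycleClass_eq_zero (n : ℕ) (z : LinearMap.ker (M.d n (n - 1)).hom) (w : M.X (n + 1))
    (h : (M.d (n + 1) n).hom w = z) : cycleClass M n z = 0 := by
  obtain ⟨z, hz⟩ := z
  subst h
  exact cycleClass_boundary n w hz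

/-- The pairing `[x] × [y] = [x × y]` on homology induced by a pairing of chain complexes. -/
noncomputable def ChainPairing.onHomology (B : ChainPairing K L M) (p q n : ℕ) :
    K.homology p →ₗ[ℝ] L.homology q →ₗ[ℝ] M.homology n :=
  descendAlong₂ (K.homologyπ p).hom (homologyπ_surjective K p)
    (L.homologyπ q).hom (homologyπ_surjective L q) (B.onCycles p q n)
    (fun x y hx => by
      obtain ⟨w, hw⟩ := exists_boundary_of_homologyπ_eq_zero K p x hx
      refine cycleClass_eq_zero n _ (B.app (p + 1) q (n + 1) w ((L.iCycles q).hom y)) ?_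
      have h := B.leibniz (p + 1) q n w ((L.iCycles q).hom y)
      rw [d_iCycles_apply] at h
      simpa [hw] using h)
    (fun x y hy => by
      obtain ⟨w, hw⟩ := exists_boundary_of_homologyπ_eq_zero L q y hy
      refine cycleClass_eq_zero n _
        ((-1 : ℤ) ^ p • B.app p (q + 1) (n + 1) ((K.iCycles p).hom x) w) ?_
      have h := B.leibniz p (q + 1) n ((K.iCycles p).hom x) w
      rw [d_iCycles_apply] at h
      rw [map_zsmul, h]
      simp [hw, smul_smul, ← mul_pow])

/-- The map from `L` to the quotient complex `L / K` along `f : K ⟶ L` is surjective. -/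
lemma cokernel_π_surjective (f : K ⟶ L) (n : ℕ) :
    Function.Surjective ((cokernel.π f).f n).hom :=
  (ModuleCat.epi_iff_surjective _).1 inferInstance

lemma exists_of_cokernel_π_eq_zero (f : K ⟶ L) (n : ℕ) (y : L.X n)
    (hy : ((cokernel.π f).f n).hom y = 0) : ∃ x, (f.f n).hom x = y := by
  have hex : (ShortComplex.mk f (cokernel.π f) (cokernel.condition f)).Exact :=
    ShortComplex.exact_cokernel f
  have := hex.map (HomologicalComplex.eval _ _ n)
  exact (ShortComplex.moduleCat_exact_iff _).1 this y hy

lemma cokernel_π_f_apply (f : K ⟶ L) (n : ℕ) (x : K.X n) :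
    ((cokernel.π f).f n).hom ((f.f n).hom x) = 0 := by
  rw [← ModuleCat.comp_apply, ← HomologicalComplex.comp_f, cokernel.condition]; rfl

/-- The commutation of the projection to the quotient complex with the differentials. -/
lemma cokernel_d_apply (f : K ⟶ L) (n m : ℕ) (x : L.X n) :
    ((cokernel f).d n m).hom (((cokernel.π f).f n).hom x) =
      ((cokernel.π f).f m).hom ((L.d n m).hom x) := by
  rw [← ModuleCat.comp_apply, ← ModuleCat.comp_apply, HomologicalComplex.Hom.comm]

section Quotients

variable {K' L' M' : ChainComplex (ModuleCat.{0} ℝ) ℕ}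
  (B : ChainPairing K L M) (f : K' ⟶ K) (g : L' ⟶ L) (h : M' ⟶ M)
  (hf : ∀ p q n x y, ∃ z, (h.f n).hom z = B.app p q n ((f.f p).hom x) y)
  (hg : ∀ p q n x y, ∃ z, (h.f n).hom z = B.app p q n x ((g.f q).hom y))

/-- The bilinear map on the quotients of the chain modules that is induced by a pairing which
carries the subcomplexes into the subcomplex. -/
noncomputable def ChainPairing.quotientApp (p q n : ℕ) :
    (cokernel f).X p →ₗ[ℝ] (cokernel g).X q →ₗ[ℝ] (cokernel h).X n :=
  descendAlong₂ ((cokernel.π f).f p).hom (cokernel_π_surjective f p)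
    ((cokernel.π g).f q).hom (cokernel_π_surjective g q)
    ((B.app p q n).compr₂ ((cokernel.π h).f n).hom)
    (fun x y hx => by
      obtain ⟨x, rfl⟩ := exists_of_cokernel_π_eq_zero f p x hx
      obtain ⟨z, hz⟩ := hf p q n x y
      rw [LinearMap.compr₂_apply, ← hz, cokernel_π_f_apply])
    (fun x y hy => by
      obtain ⟨y, rfl⟩ := exists_of_cokernel_π_eq_zero g q y hy
      obtain ⟨z, hz⟩ := hg p q n x y
      rw [LinearMap.compr₂_apply, ← hz, cokernel_π_f_apply])

lemma ChainPairing.quotientApp_apply (p q n : ℕ) (x : K.X p) (y : L.X q) :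
    B.quotientApp f g h hf hg p q n (((cokernel.π f).f p).hom x) (((cokernel.π g).f q).hom y) =
      ((cokernel.π h).f n).hom (B.app p q n x y) :=
  descendAlong₂_apply _ _ _ _ _ _ _ x y

/-- The pairing of quotient complexes induced by a pairing of complexes that carries the
subcomplexes into the subcomplex. -/
noncomputable def ChainPairing.onQuotients :
    ChainPairing (cokernel f) (cokernel g) (cokernel h) where
  app := B.quotientApp f g h hf hg
  leibniz p q n x y := by
    obtain ⟨x, rfl⟩ := cokernel_π_surjective f p x
    obtain ⟨y, rfl⟩ := cokernel_π_surjective g q y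
    rw [cokernel_d_apply, cokernel_d_apply, B.quotientApp_apply, B.quotientApp_apply,
      B.quotientApp_apply, cokernel_d_apply, B.leibniz, map_add, map_zsmul]

end Quotients

end HomologicalAlgebra

section SingularChains

/-- The singular chain complex of `X` with coefficients in `ℝ`. -/
noncomputable def singularChains (X : Type) [TopologicalSpace X] :
    ChainComplex (ModuleCat.{0} ℝ) ℕ :=
  ((singularChainComplexFunctor (ModuleCat.{0} ℝ)).obj (ModuleCat.of ℝ ℝ)).obj (TopCat.of X)

/-- The map on singular chains induced by a continuous map. -/
noncomputable def singularChainsMap {X Y : Type} [TopologicalSpace X] [TopologicalSpace Y]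
    (f : C(X, Y)) : singularChains X ⟶ singularChains Y :=
  ((singularChainComplexFunctor (ModuleCat.{0} ℝ)).obj (ModuleCat.of ℝ ℝ)).map (TopCat.ofHom f)

/-- The singular `n`-simplices of `X`: continuous maps from the standard `n`-simplex to `X`. -/
abbrev SingularSimplex (n : ℕ) (X : Type) [TopologicalSpace X] : Type :=
  (TopCat.toSSet.obj (TopCat.of X)).obj (Opposite.op (SimplexCategory.mk n))

/-- The simplex `σ ∘ α_*`, where `α_* : Δⁿ → Δᵖ` is the affine map given on vertices by `α`. -/
noncomputable def SingularSimplex.pull {n p : ℕ} {X : Type} [TopologicalSpace X]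
    (α : Fin (n + 1) →o Fin (p + 1)) (σ : SingularSimplex p X) : SingularSimplex n X :=
  (TopCat.toSSet.obj (TopCat.of X)).map (SimplexCategory.mkHom α).op σ

/-- The composite of a singular simplex with a continuous map. -/
noncomputable def SingularSimplex.push {n : ℕ} {X Y : Type} [TopologicalSpace X]
    [TopologicalSpace Y] (f : C(X, Y)) (σ : SingularSimplex n X) : SingularSimplex n Y :=
  (TopCat.toSSet.map (TopCat.ofHom f)).app _ σ

/-- The simplex `t ↦ (σ t, τ t)` of `X × Y`. -/
noncomputable def SingularSimplex.pair {n : ℕ} {X Y : Type} [TopologicalSpace X]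
    [TopologicalSpace Y] (σ : SingularSimplex n X) (τ : SingularSimplex n Y) :
    SingularSimplex n (X × Y) :=
  ULift.up (TopCat.ofHom (ContinuousMap.prodMk σ.down.hom τ.down.hom))

/-- A singular simplex, regarded as a singular chain. -/
noncomputable def simplexChain {n : ℕ} {X : Type} [TopologicalSpace X] (σ : SingularSimplex n X) :
    (singularChains X).X n :=
  (SSet.ιChainComplex (R := ModuleCat.of ℝ ℝ) (TopCat.toSSet.obj (TopCat.of X)) σ).hom (1 : ℝ)

/-- The linear extension to singular chains of a function on singular simplices. -/
noncomputable def chainLift {n : ℕ} {X : Type} [TopologicalSpace X] {V : Type} [AddCommGroup V]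
    [Module ℝ V] (F : SingularSimplex n X → V) : (singularChains X).X n →ₗ[ℝ] V :=
  (Sigma.desc (f := fun _ : SingularSimplex n X => ModuleCat.of ℝ ℝ)
    (P := ModuleCat.of ℝ V) (fun σ => ModuleCat.ofHom (LinearMap.toSpanSingleton ℝ V (F σ)))).hom

@[simp] lemma chainLift_simplexChain {n : ℕ} {X : Type} [TopologicalSpace X] {V : Type}
    [AddCommGroup V] [Module ℝ V] (F : SingularSimplex n X → V) (σ : SingularSimplex n X) :
    chainLift F (simplexChain σ) = F σ := by
  have h := Sigma.ι_desc (f := fun _ : SingularSimplex n X => ModuleCat.of ℝ ℝ)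
    (P := ModuleCat.of ℝ V)
    (fun σ => ModuleCat.ofHom (LinearMap.toSpanSingleton ℝ V (F σ))) σ
  have h' := congrArg (fun φ => φ.hom (1 : ℝ)) h
  have h'' : chainLift F (simplexChain σ) = LinearMap.toSpanSingleton ℝ V (F σ) 1 := h'
  rw [h'', LinearMap.toSpanSingleton_apply, one_smul]

lemma chain_hom_ext {n : ℕ} {X : Type} [TopologicalSpace X] {V : Type} [AddCommGroup V]
    [Module ℝ V] {f g : (singularChains X).X n →ₗ[ℝ] V}
    (h : ∀ σ : SingularSimplex n X, f (simplexChain σ) = g (simplexChain σ)) : f = g := by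
  have : ModuleCat.ofHom f = ModuleCat.ofHom g := by
    refine SSet.chainComplex_hom_ext (X := TopCat.toSSet.obj (TopCat.of X))
      (R := ModuleCat.of ℝ ℝ) (T := ModuleCat.of ℝ V) (n := n) (fun σ => ?_)
    ext
    exact h σ
  exact congrArg ModuleCat.Hom.hom this

lemma d_simplexChain {n : ℕ} {X : Type} [TopologicalSpace X] (σ : SingularSimplex (n + 1) X) :
    ((singularChains X).d (n + 1) n).hom (simplexChain σ) =
      ∑ i : Fin (n + 2), (-1 : ℤ) ^ i.val • simplexChain (σ.pull (faceHom i)) := by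
  have h := SSet.ιChainComplex_d (R := ModuleCat.of ℝ ℝ) (TopCat.toSSet.obj (TopCat.of X)) σ
  have h' := congrArg (fun φ => φ.hom (1 : ℝ)) h
  simp only [ModuleCat.hom_sum, ModuleCat.hom_zsmul, LinearMap.sum_apply] at h'
  exact h'

lemma map_simplexChain {n : ℕ} {X Y : Type} [TopologicalSpace X] [TopologicalSpace Y]
    (f : C(X, Y)) (σ : SingularSimplex n X) :
    ((singularChainsMap f).f n).hom (simplexChain σ) = simplexChain (σ.push f) := by
  have h := SSet.ι_chainComplexMap_f _ _ (TopCat.toSSet.map (TopCat.ofHom f)) (ModuleCat.of ℝ ℝ) σ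
  exact congrArg (fun φ => φ.hom (1 : ℝ)) h

lemma SingularSimplex.pull_pull {n p r : ℕ} {X : Type} [TopologicalSpace X]
    (α : Fin (n + 1) →o Fin (p + 1)) (β : Fin (p + 1) →o Fin (r + 1)) (σ : SingularSimplex r X) :
    (σ.pull β).pull α = σ.pull (β.comp α) := by
  unfold SingularSimplex.pull
  rw [← Functor.map_comp_apply, ← op_comp]
  rfl

lemma SingularSimplex.pull_push {n p : ℕ} {X Y : Type} [TopologicalSpace X] [TopologicalSpace Y]
    (α : Fin (n + 1) →o Fin (p + 1)) (f : C(X, Y)) (σ : SingularSimplex p X) :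
    (σ.push f).pull α = (σ.pull α).push f := rfl

lemma SingularSimplex.pull_pair {n p : ℕ} {X Y : Type} [TopologicalSpace X] [TopologicalSpace Y]
    (α : Fin (n + 1) →o Fin (p + 1)) (σ : SingularSimplex p X) (τ : SingularSimplex p Y) :
    (σ.pair τ).pull α = (σ.pull α).pair (τ.pull α) := rfl

lemma SingularSimplex.push_pair {n : ℕ} {X Y X' Y' : Type} [TopologicalSpace X]
    [TopologicalSpace Y] [TopologicalSpace X'] [TopologicalSpace Y'] (f : C(X, X')) (g : C(Y, Y'))
    (σ : SingularSimplex n X) (τ : SingularSimplex n Y) :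
    (σ.pair τ).push (f.prodMap g) = (σ.push f).pair (τ.push g) := rfl

/-- The cross product `σ × τ = ∑ sgn(α, β) • (σ ∘ α_*, τ ∘ β_*)` of two singular simplices, the sum
over all `(p, q)`-shuffles: the standard triangulation of the prism `Δᵖ × Δ^q`. Here `n = p + q`. -/
noncomputable def crossSimplex {p q : ℕ} (n : ℕ) {X Y : Type} [TopologicalSpace X]
    [TopologicalSpace Y] (σ : SingularSimplex p X) (τ : SingularSimplex q Y) :
    (singularChains (X × Y)).X n :=
  shuffleSum n p q fun α β => simplexChain ((σ.pull α).pair (τ.pull β))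

/-- The bilinear extension of the cross product of simplices to chains. -/
noncomputable def crossApp (X Y : Type) [TopologicalSpace X] [TopologicalSpace Y] (p q n : ℕ) :
    (singularChains X).X p →ₗ[ℝ] (singularChains Y).X q →ₗ[ℝ] (singularChains (X × Y)).X n :=
  chainLift fun σ => chainLift fun τ => crossSimplex n σ τ

lemma crossApp_simplexChain {X Y : Type} [TopologicalSpace X] [TopologicalSpace Y] {p q : ℕ}
    (n : ℕ) (σ : SingularSimplex p X) (τ : SingularSimplex q Y) :
    crossApp X Y p q n (simplexChain σ) (simplexChain τ) = crossSimplex n σ τ := by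
  simp [crossApp]

lemma d_crossSimplex {X Y : Type} [TopologicalSpace X] [TopologicalSpace Y] (p q n : ℕ)
    (σ : SingularSimplex p X) (τ : SingularSimplex q Y) :
    ((singularChains (X × Y)).d (n + 1) n).hom (crossSimplex (n + 1) σ τ) =
      crossApp X Y (p - 1) q n (((singularChains X).d p (p - 1)).hom (simplexChain σ))
        (simplexChain τ) +
      (-1 : ℤ) ^ p • crossApp X Y p (q - 1) n (simplexChain σ)
        (((singularChains Y).d q (q - 1)).hom (simplexChain τ)) := by
  have h := shuffleSum_boundary n p q
    (fun α β => simplexChain ((σ.pull α).pair (τ.pull β)))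
  have h1 : ((singularChains (X × Y)).d (n + 1) n).hom (crossSimplex (n + 1) σ τ) =
      ∑ i : Fin (n + 2), (-1 : ℤ) ^ i.val • shuffleSum (n + 1) p q (fun α β =>
        simplexChain ((σ.pull (α.comp (faceHom i))).pair (τ.pull (β.comp (faceHom i))))) := by
    unfold crossSimplex
    have := map_shuffleSum
      (((singularChains (X × Y)).d (n + 1) n).hom : _ →ₗ[ℝ] _).toAddMonoidHom (n + 1) p q
      (fun α β => simplexChain ((σ.pull α).pair (τ.pull β)))
    refine this.trans ?_
    simp only [LinearMap.toAddMonoidHom_coe, d_simplexChain, SingularSimplex.pull_pair,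
      SingularSimplex.pull_pull, shuffleSum_sum, shuffleSum_zsmul]
  rw [h1, h]
  congr 1
  · cases p with
    | zero => rw [(singularChains X).shape _ _ (by simp)]; simp [faceLeft]
    | succ p =>
      change _ = crossApp X Y p q n (((singularChains X).d (p + 1) p).hom (simplexChain σ))
        (simplexChain τ)
      simp only [d_simplexChain, map_sum, map_zsmul, LinearMap.sum_apply,
        LinearMap.smul_apply, crossApp_simplexChain, crossSimplex, faceLeft,
        SingularSimplex.pull_pull]
  · congr 1
    cases q with
    | zero => rw [(singularChains Y).shape _ _ (by simp)]; simp [faceRight]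
    | succ q =>
      change _ = crossApp X Y p q n (simplexChain σ)
        (((singularChains Y).d (q + 1) q).hom (simplexChain τ))
      simp only [d_simplexChain, map_sum, map_zsmul,
        crossApp_simplexChain, crossSimplex, faceRight, SingularSimplex.pull_pull]

lemma crossApp_natural {X Y X' Y' : Type} [TopologicalSpace X]
    [TopologicalSpace Y] [TopologicalSpace X'] [TopologicalSpace Y'] (f : C(X, X')) (g : C(Y, Y'))
    (p q n : ℕ) (x : (singularChains X).X p) (y : (singularChains Y).X q) :
    ((singularChainsMap (f.prodMap g)).f n).hom (crossApp X Y p q n x y) =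
      crossApp X' Y' p q n (((singularChainsMap f).f p).hom x)
        (((singularChainsMap g).f q).hom y) := by
  have h : (crossApp X Y p q n).compr₂ ((singularChainsMap (f.prodMap g)).f n).hom =
      (crossApp X' Y' p q n).compl₁₂ ((singularChainsMap f).f p).hom
        ((singularChainsMap g).f q).hom := by
    refine chain_hom_ext fun σ => chain_hom_ext fun τ => ?_
    simp only [LinearMap.compr₂_apply, LinearMap.compl₁₂_apply, map_simplexChain,
      crossApp_simplexChain]
    unfold crossSimplex
    refine (map_shuffleSum (((singularChainsMap (f.prodMap g)).f n).hom :
      _ →ₗ[ℝ] _).toAddMonoidHom n p q _).trans ?_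
    simp only [LinearMap.toAddMonoidHom_coe, map_simplexChain, SingularSimplex.push_pair,
      SingularSimplex.pull_push]
  exact LinearMap.congr_fun₂ h x y

/-- The cross product of singular chains. -/
noncomputable def chainCross (X Y : Type) [TopologicalSpace X] [TopologicalSpace Y] :
    ChainPairing (singularChains X) (singularChains Y) (singularChains (X × Y)) where
  app := crossApp X Y
  leibniz p q n x y := by
    have h : (crossApp X Y p q (n + 1)).compr₂ ((singularChains (X × Y)).d (n + 1) n).hom =
        (crossApp X Y (p - 1) q n).comp ((singularChains X).d p (p - 1)).hom +
        (-1 : ℤ) ^ p • (crossApp X Y p (q - 1) n).compl₂ ((singularChains Y).d q (q - 1)).hom := by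
      refine chain_hom_ext fun σ => chain_hom_ext fun τ => ?_
      simp only [LinearMap.compr₂_apply, crossApp_simplexChain, LinearMap.add_apply,
        LinearMap.smul_apply, LinearMap.comp_apply, LinearMap.compl₂_apply]
      exact d_crossSimplex p q n σ τ
    exact LinearMap.congr_fun₂ h x y

end SingularChains

section RelativeHomology

variable {X Y : Type} [TopologicalSpace X] [TopologicalSpace Y]

/-- The singular homology `H_n(X)` with coefficients in `ℝ`. -/
noncomputable abbrev Homology (n : ℕ) (X : Type) [TopologicalSpace X] : ModuleCat.{0} ℝ :=
  (singularChains X).homology n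

/-- The inclusion `A → X` of a subspace. -/
def inclusionMap (A : Set X) : C(A, X) := ⟨Subtype.val, continuous_subtype_val⟩

/-- The relative singular chain complex `C(X, A) = C(X) / C(A)` with coefficients in `ℝ`. -/
noncomputable def relChains (A : Set X) : ChainComplex (ModuleCat.{0} ℝ) ℕ :=
  cokernel (singularChainsMap (inclusionMap A))

/-- The relative singular homology `H_n(X, A)` with coefficients in `ℝ`. -/
noncomputable abbrev RelHomology (n : ℕ) (A : Set X) : ModuleCat.{0} ℝ :=
  (relChains A).homology n

lemma singularChainsMap_comp {Z : Type} [TopologicalSpace Z] (g : C(Y, Z)) (f : C(X, Y)) :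
    singularChainsMap (g.comp f) = singularChainsMap f ≫ singularChainsMap g :=
  ((singularChainComplexFunctor (ModuleCat.{0} ℝ)).obj (ModuleCat.of ℝ ℝ)).map_comp
    (TopCat.ofHom f) (TopCat.ofHom g)

lemma singularChainsMap_id :
    singularChainsMap (ContinuousMap.id X) = 𝟙 (singularChains X) :=
  ((singularChainComplexFunctor (ModuleCat.{0} ℝ)).obj (ModuleCat.of ℝ ℝ)).map_id (TopCat.of X)

/-- The restriction `A → B` of a map `f : X → Y` with `f(A) ⊆ B`. -/
def restrictMap {A : Set X} {B : Set Y} (f : C(X, Y)) (hf : Set.MapsTo f A B) : C(A, B) :=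
  ⟨hf.restrict f A B, f.continuous.restrict hf⟩

/-- The chain map `C(X, A) → C(Y, B)` induced by a map of pairs. -/
noncomputable def relChainsMap {A : Set X} {B : Set Y} (f : C(X, Y)) (hf : Set.MapsTo f A B) :
    relChains A ⟶ relChains B :=
  cokernel.map _ _ (singularChainsMap (restrictMap f hf)) (singularChainsMap f) (by
    rw [← singularChainsMap_comp, ← singularChainsMap_comp]; rfl)

/-- The map `f_* : H_n(X, A) → H_n(Y, B)` induced by a map of pairs `f : (X, A) → (Y, B)`. -/
noncomputable def relHomologyMap (n : ℕ) {A : Set X} {B : Set Y} (f : C(X, Y))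
    (hf : Set.MapsTo f A B) : RelHomology n A →ₗ[ℝ] RelHomology n B :=
  (HomologicalComplex.homologyMap (relChainsMap f hf) n).hom

instance mono_inclusion (A : Set X) : Mono (singularChainsMap (inclusionMap A)) := by
  have : Mono (TopCat.ofHom (inclusionMap A)) :=
    (TopCat.mono_iff_injective _).2 Subtype.val_injective
  exact inferInstanceAs (Mono (((singularChainComplexFunctor (ModuleCat.{0} ℝ)).obj
    (ModuleCat.of ℝ ℝ)).map (TopCat.ofHom (inclusionMap A))))

/-- The short exact sequence `0 → C(A) → C(X) → C(X, A) → 0`. -/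
noncomputable def pairSequence (A : Set X) : ShortComplex (ChainComplex (ModuleCat.{0} ℝ) ℕ) :=
  ShortComplex.mk (singularChainsMap (inclusionMap A))
    (cokernel.π (singularChainsMap (inclusionMap A))) (cokernel.condition _)

lemma pairSequence_shortExact (A : Set X) : (pairSequence A).ShortExact where
  exact := ShortComplex.exact_cokernel _
  mono_f := mono_inclusion A
  epi_g := coequalizer.π_epi

/-- The connecting homomorphism `∂_* : H_n(X, A) → H_m(A)`, `n = m + 1`, of the long exact
sequence of the pair `(X, A)`. -/
noncomputable def connecting (A : Set X) (n m : ℕ) (h : m + 1 = n) :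
    RelHomology n A →ₗ[ℝ] Homology m A :=
  ((pairSequence_shortExact A).δ n m h).hom

/-- For `A ⊆ X` and `B ⊆ Y`, the subset `A × Y ∪ X × B` of `X × Y`. -/
def pairProd (A : Set X) (B : Set Y) : Set (X × Y) := A ×ˢ Set.univ ∪ Set.univ ×ˢ B

/-- The cross product of relative chains. -/
noncomputable def relChainCross (A : Set X) (B : Set Y) :
    ChainPairing (relChains A) (relChains B) (relChains (pairProd A B)) :=
  (chainCross X Y).onQuotients _ _ _
    (fun p q n x y => by
      refine ⟨((singularChainsMap (⟨fun z => ⟨(z.1.1, z.2), Or.inl ⟨z.1.2, trivial⟩⟩,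
        by fun_prop⟩ : C(A × Y, pairProd A B))).f n).hom (crossApp A Y p q n x y), ?_⟩
      have h := crossApp_natural (inclusionMap A) (ContinuousMap.id Y) p q n x y
      rw [singularChainsMap_id] at h
      refine Eq.trans ?_ h
      rw [← ModuleCat.comp_apply, ← HomologicalComplex.comp_f, ← singularChainsMap_comp]
      rfl)
    (fun p q n x y => by
      refine ⟨((singularChainsMap (⟨fun z => ⟨(z.1, z.2.1), Or.inr ⟨trivial, z.2.2⟩⟩,
        by fun_prop⟩ : C(X × B, pairProd A B))).f n).hom (crossApp X B p q n x y), ?_⟩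
      have h := crossApp_natural (ContinuousMap.id X) (inclusionMap B) p q n x y
      rw [singularChainsMap_id] at h
      refine Eq.trans ?_ h
      rw [← ModuleCat.comp_apply, ← HomologicalComplex.comp_f, ← singularChainsMap_comp]
      rfl)

/-- The homology cross product
`H_p(X, A) × H_q(Y, B) → H_n(X × Y, A × Y ∪ X × B)`, for `n = p + q`. -/
noncomputable def relCross (A : Set X) (B : Set Y) (p q n : ℕ) :
    RelHomology p A →ₗ[ℝ] RelHomology q B →ₗ[ℝ] RelHomology n (pairProd A B) :=
  (relChainCross A B).onHomology p q n

end RelativeHomology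

section Linking

variable {D : ℕ} {X Y : Set (EuclideanSpace ℝ (Fin D))}

/-- The map `p : X × Y → ℝ^D`, `p(x, y) = x - y`. -/
def differenceMap (X Y : Set (EuclideanSpace ℝ (Fin D))) : C(X × Y, EuclideanSpace ℝ (Fin D)) :=
  ⟨fun z => z.1 - z.2, by fun_prop⟩

lemma differenceMap_mapsTo {A : Set X} {B : Set Y}
    (hAY : ∀ a ∈ A, (a : EuclideanSpace ℝ (Fin D)) ∉ Y)
    (hXB : ∀ b ∈ B, (b : EuclideanSpace ℝ (Fin D)) ∉ X) :
    Set.MapsTo (differenceMap X Y) (pairProd A B) {0}ᶜ := by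
  rintro ⟨x, y⟩ h h0
  have hxy : (x : EuclideanSpace ℝ (Fin D)) = y := sub_eq_zero.1 h0
  rcases h with ⟨hx, -⟩ | ⟨-, hy⟩
  · exact hAY x hx (hxy ▸ y.2)
  · exact hXB y hy (hxy ▸ x.2)

/-- The group `H_D(ℝ^D, ℝ^D ∖ {0})`, in which intersection and linking numbers take their
values. -/
noncomputable abbrev LocalHomology (D : ℕ) : ModuleCat.{0} ℝ :=
  RelHomology D ({0}ᶜ : Set (EuclideanSpace ℝ (Fin D)))

/-- The intersection pairing `H_N(X, A) × H_{D-N}(Y, B) → H_D(ℝ^D, ℝ^D ∖ {0})`,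
`𝓘(ζ, μ) = (-1)^{D-N} p_*(ζ × μ)`. It is used for `N ≤ D` only. -/
noncomputable def intersectionNumber (N : ℕ) {A : Set X} {B : Set Y}
    (hAY : ∀ a ∈ A, (a : EuclideanSpace ℝ (Fin D)) ∉ Y)
    (hXB : ∀ b ∈ B, (b : EuclideanSpace ℝ (Fin D)) ∉ X)
    (ζ : RelHomology N A) (μ : RelHomology (D - N) B) : LocalHomology D :=
  (-1 : ℝ) ^ (D - N) • relHomologyMap D (differenceMap X Y) (differenceMap_mapsTo hAY hXB)
    (relCross A B N (D - N) D ζ μ)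

/-- `ℓ` is a linking number of `ς ∈ H_{N-1}(A)` and `μ ∈ H_{D-N}(Y, B)`: there is
`ζ ∈ H_N(X, A)` with `∂_* ζ = ς` and `ℓ = 𝓘(ζ, μ)`. -/
def IsLinkingNumber (N : ℕ) (hN : 1 < N) {A : Set X} {B : Set Y}
    (hAY : ∀ a ∈ A, (a : EuclideanSpace ℝ (Fin D)) ∉ Y)
    (hXB : ∀ b ∈ B, (b : EuclideanSpace ℝ (Fin D)) ∉ X)
    (ς : Homology (N - 1) A) (μ : RelHomology (D - N) B) (ℓ : LocalHomology D) : Prop :=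
  ∃ ζ : RelHomology N A, connecting A N (N - 1) (Nat.sub_add_cancel hN.le) ζ = ς ∧
    ℓ = intersectionNumber N hAY hXB ζ μ

end Linking

end LinkingNumbers

open LinkingNumbers

/-!
Since `H_N(X) = H_{N-1}(X) = 0`, the long exact sequence of the pair `(X, A)` makes the connecting
map `∂_* : H_N(X, A) → H_{N-1}(A)` an isomorphism (`connecting_bijective`). Every class `ς` is
thus `∂_* ζ` for exactly one `ζ`, and its only linking number with `μ` is the value at `ς` of the linear map
`𝓘(·, μ) ∘ ∂_*⁻¹`. This map is non-zero by assumption, and a non-zero linear map out of the line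
`H_{N-1}(A) ≅ ℝ` is injective.
-/

namespace LinkingNumbers

/-- If `H_n(X)` and `H_m(X)` vanish, `n = m + 1`, then the connecting homomorphism
`H_n(X, A) → H_m(A)` is an isomorphism, by the long exact sequence of the pair. -/
lemma connecting_bijective {X : Type} [TopologicalSpace X] (A : Set X) (n m : ℕ) (h : m + 1 = n)
    (hn : Subsingleton (Homology n X)) (hm : Subsingleton (Homology m X)) :
    Function.Bijective (connecting A n m h) := by
  have := (pairSequence_shortExact A).isIso_δ n m h
    (@ModuleCat.isZero_of_subsingleton _ _ (Homology n X) hn)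
    (@ModuleCat.isZero_of_subsingleton _ _ (Homology m X) hm)
  exact ConcreteCategory.bijective_of_isIso ((pairSequence_shortExact A).δ n m h)

/-- The intersection number with a fixed class `μ`, as a linear map
`H_N(X, A) → H_D(ℝ^D, ℝ^D ∖ {0})` in the first class. -/
noncomputable def intersectionHom {D : ℕ} {X Y : Set (EuclideanSpace ℝ (Fin D))} (N : ℕ) {A : Set X}
    {B : Set Y} (hAY : ∀ a ∈ A, (a : EuclideanSpace ℝ (Fin D)) ∉ Y)
    (hXB : ∀ b ∈ B, (b : EuclideanSpace ℝ (Fin D)) ∉ X) (μ : RelHomology (D - N) B) :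
    RelHomology N A →ₗ[ℝ] LocalHomology D :=
  (-1 : ℝ) ^ (D - N) • relHomologyMap D (differenceMap X Y) (differenceMap_mapsTo hAY hXB) ∘ₗ
    (relCross A B N (D - N) D).flip μ

end LinkingNumbers

/-- A non-zero linear map out of a line is injective. -/
lemma LinearMap.injective_of_linearEquiv_field {K V W : Type*} [Field K] [AddCommGroup V]
    [Module K V] [AddCommGroup W] [Module K W] (e : V ≃ₗ[K] K) (f : V →ₗ[K] W) (hf : f ≠ 0) :
    Function.Injective f := by
  have : IsSimpleModule K V := IsSimpleModule.congr e
  exact f.injective_of_ne_zero hf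

theorem mainTheorem5 {D N : ℕ} (hN : 1 < N) (hND : N ≤ D)
    (X Y : Set (EuclideanSpace ℝ (Fin D))) (A : Set X) (B : Set Y)
    (hAY : ∀ a ∈ A, (a : EuclideanSpace ℝ (Fin D)) ∉ Y)
    (hXB : ∀ b ∈ B, (b : EuclideanSpace ℝ (Fin D)) ∉ X)
    (hX : Subsingleton (Homology N X)) (hX' : Subsingleton (Homology (N - 1) X))
    (hXA : Nonempty (RelHomology N A ≃ₗ[ℝ] Homology (N - 1) A))
    (hA : Nonempty (Homology (N - 1) A ≃ₗ[ℝ] ℝ))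
    (μ : RelHomology (D - N) B) (hμ : μ ≠ 0)
    (hlink : ∃ ς ℓ, IsLinkingNumber N hN hAY hXB ς μ ℓ ∧ ℓ ≠ 0) :
    ∃ 𝓗 : Homology (N - 1) A →ₗ[ℝ] LocalHomology D,
      (∀ ς ℓ, IsLinkingNumber N hN hAY hXB ς μ ℓ ↔ ℓ = 𝓗 ς) ∧
      Function.Injective 𝓗 ∧
      ∀ e : LocalHomology D ≃ₗ[ℝ] ℝ, Function.Injective fun ς => e (𝓗 ς) := by
  let δ := LinearEquiv.ofBijective (connecting A N (N - 1) (Nat.sub_add_cancel hN.le))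
    (connecting_bijective A N (N - 1) (Nat.sub_add_cancel hN.le) hX hX')
  let 𝓗 : Homology (N - 1) A →ₗ[ℝ] LocalHomology D :=
    intersectionHom N hAY hXB μ ∘ₗ δ.symm.toLinearMap
  have key : ∀ ς ℓ, IsLinkingNumber N hN hAY hXB ς μ ℓ ↔ ℓ = 𝓗 ς := by
    intro ς ℓ
    constructor
    · rintro ⟨ζ, hζ, rfl⟩
      have : δ.symm ς = ζ := (LinearEquiv.symm_apply_eq δ).2 hζ.symm
      exact congrArg (intersectionHom N hAY hXB μ) this.symm
    · rintro rfl
      exact ⟨δ.symm ς, δ.apply_symm_apply ς, rfl⟩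
  have h𝓗 : 𝓗 ≠ 0 := by
    obtain ⟨ς, ℓ, hℓ, hne⟩ := hlink
    intro h0
    exact hne (by rw [(key ς ℓ).1 hℓ, h0, LinearMap.zero_apply])
  obtain ⟨eA⟩ := hA
  have hinj := LinearMap.injective_of_linearEquiv_field eA 𝓗 h𝓗
  exact ⟨𝓗, key, hinj, fun e => e.injective.comp hinj⟩
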